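/- For an integer $n\ge 0$ and real $z>0$ let $J_n(z)=\sum_{k\ge 0}\frac{(-1)^k}{k!\,(n+k)!}\left(\frac z2\right)^{n+2k}$ be the Bessel function of the first kind and $$Y_n(z)=\frac2\pi\left(\ln\frac z2+\gamma\right)J_n(z)-\frac1\pi\sum_{k=0}^{n-1}\frac{(n-1-k)!}{k!}\left(\frac 2z\right)^{n-2k}-\frac1\pi\sum_{k\ge 0}\frac{(-1)^k}{k!\,(n+k)!}\,(H_{n+k}+H_k)\left(\frac z2\right)^{n+2k}$$ the Neumann function (Bessel function of the second kind), where $\gamma$ is Euler's constant and $H_k=\sum_{j=1}^k \frac1j$. For integers $n\ge 1$ and real $z>0$ define $$C_n(z)=-Y_n(z)\left(\frac z2\right)^n\frac{\pi}{\Gamma(n)}.$$ Then: (i) $C_n(z)>1$ for all integers $n\ge1$ and real $z>0$ with $n\ge z+1$. (ii) For each fixed integer $n\ge1$, $C_n(z)$ is a strictly increasing function of $z$ on $\{z : 0<z\le n-1\}$, and $C_n(z)\to1$ as $z\to0^+$. (iii) For each fixed real $z>0$, $C_n(z)$ is a strictly decreasing function of $n$ on the integers $n\ge z+1$, and $C_n(z)\to1$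 as $n\to\infty$. -/

import Mathlib

open Filter Topology

noncomputable section

/-- The Bessel function of the first kind of integer order `n ≥ 0` at a real argument,
`J_n(z) = ∑_{k ≥ 0} (-1)^k / (k! (n+k)!) (z/2)^(n+2k)`. -/
def besselJ (n : ℕ) (z : ℝ) : ℝ :=
  ∑' k : ℕ, (-1) ^ k / ((k.factorial : ℝ) * ((n + k).factorial : ℝ)) * (z / 2) ^ (n + 2 * k)

/-- The Neumann function (Bessel function of the second kind) of integer order `n ≥ 0` at a real
argument `z > 0`,
`Y_n(z) = (2/π) (log (z/2) + γ) J_n(z) - (1/π) ∑_{k < n} (n-1-k)!/k! (2/z)^(n-2k)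
  - (1/π) ∑_{k ≥ 0} (-1)^k / (k! (n+k)!) (H_{n+k} + H_k) (z/2)^(n+2k)`,
where `γ` is Euler's constant and `H_k = 1 + 1/2 + ⋯ + 1/k`. The exponent `n - 2k` of the finite sum
is an integer that may be negative. -/
def besselY (n : ℕ) (z : ℝ) : ℝ :=
  2 / Real.pi * (Real.log (z / 2) + Real.eulerMascheroniConstant) * besselJ n z
    - 1 / Real.pi * ∑ k ∈ Finset.range n,
        ((n - 1 - k).factorial : ℝ) / (k.factorial : ℝ) * (2 / z) ^ ((n : ℤ) - 2 * (k : ℤ))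
    - 1 / Real.pi * ∑' k : ℕ,
        (-1) ^ k / ((k.factorial : ℝ) * ((n + k).factorial : ℝ))
          * ((harmonic (n + k) : ℝ) + (harmonic k : ℝ)) * (z / 2) ^ (n + 2 * k)

/-- `C_n(z) = -Y_n(z) (z/2)^n π / Γ(n)`, for `n ≥ 1` and `z > 0`. -/
def neumannC (n : ℕ) (z : ℝ) : ℝ :=
  -besselY n z * (z / 2) ^ n * (Real.pi / Real.Gamma (n : ℝ))

end

open MeasureTheory

/-! Everything reduces to one sign: `Y_m(z) < 0` for `0 < z ≤ m`. Indeed `(z^n Y_n)' = z^n Y_{n-1}`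
makes the derivative of `C_n` a positive multiple of `-Y_{n-1}(z)`, and the three-term recurrence
makes `C_n - C_{n+1}` a positive multiple of the same quantity (`hasDerivAt_neumannC`,
`neumannC_succ_lt`). The limits at `z → 0+` and `n → ∞` are read off the series, and `C_n > 1`
follows from monotonicity in `z` and the limit at `0`.

The sign comes from Schläfli's formula: `π Y_n(z)` is the integral of `sin(z sin θ - nθ)` over `[0,
π]` minus that of `(e^{nt} + (-1)^n e^{-nt}) e^{-z sinh t}` over `t > 0`. For `0 < z ≤ n` the first
is nonpositive (`schlafliSin_nonpos`) and the second is positive (`schlafliExp_neg_lt`).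

Series and integral agree because they obey the same recurrence in `n`, while for orders `0` and `1`
they solve the same first-order linear system. The differences tend to `0` at the origin and their
sum of squares is nonincreasing, so they vanish (`neumannW_zero_one_add_neumannIntegral`). Euler's
constant enters the integral's expansion at the origin through `Γ'(1) = -γ`. -/

/-! ### Power series with coefficients `O(1/k!)`. -/

/-- The sum of the power series with coefficients `c`. -/
noncomputable def powSum (c : ℕ → ℝ) (q : ℝ) : ℝ := ∑' k : ℕ, c k * q ^ k

theorem powSum_term_le {c : ℕ → ℝ} {M : ℝ} (hc : ∀ k : ℕ, |c k| ≤ M / (k.factorial : ℝ)) (q : ℝ)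
    (k : ℕ) : ‖c k * q ^ k‖ ≤ M * (|q| ^ k / (k.factorial : ℝ)) := by
  rw [Real.norm_eq_abs, abs_mul, abs_pow]
  calc |c k| * |q| ^ k ≤ M / (k.factorial : ℝ) * |q| ^ k := by gcongr; exact hc k
    _ = _ := by ring

theorem powSum_summable {c : ℕ → ℝ} {M : ℝ} (hc : ∀ k : ℕ, |c k| ≤ M / (k.factorial : ℝ)) (q : ℝ) :
    Summable fun k : ℕ => c k * q ^ k :=
  Summable.of_norm_bounded ((Real.summable_pow_div_factorial |q|).mul_left M) (powSum_term_le hc q)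

theorem hasSum_pow_div_factorial (q : ℝ) :
    HasSum (fun k : ℕ => q ^ k / (k.factorial : ℝ)) (Real.exp q) := by
  rw [Real.exp_eq_exp_ℝ]
  exact NormedSpace.expSeries_div_hasSum_exp q

theorem abs_powSum_le {c : ℕ → ℝ} {M : ℝ} (hc : ∀ k : ℕ, |c k| ≤ M / (k.factorial : ℝ)) (q : ℝ) :
    |powSum c q| ≤ M * Real.exp |q| :=
  tsum_of_norm_bounded ((hasSum_pow_div_factorial |q|).mul_left M) (powSum_term_le hc q)

theorem powSum_eq_add {c : ℕ → ℝ} {M : ℝ} (hc : ∀ k : ℕ, |c k| ≤ M / (k.factorial : ℝ)) (q : ℝ) :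
    powSum c q = c 0 + q * powSum (fun k => c (k + 1)) q := by
  unfold powSum
  rw [(powSum_summable hc q).tsum_eq_zero_add, ← tsum_mul_left]
  simp only [pow_zero, mul_one]
  congr 2
  funext k
  ring

theorem powSum_zero {c : ℕ → ℝ} {M : ℝ} (hc : ∀ k : ℕ, |c k| ≤ M / (k.factorial : ℝ)) :
    powSum c 0 = c 0 := by
  rw [powSum_eq_add hc]; ring

theorem hasDerivAt_powSum {c : ℕ → ℝ} {M : ℝ} (hc : ∀ k : ℕ, |c k| ≤ M / (k.factorial : ℝ))
    (q : ℝ) : HasDerivAt (powSum c) (powSum (fun k : ℕ => ((k : ℝ) + 1) * c (k + 1)) q) q := by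
  have hM : 0 ≤ M := by have := (abs_nonneg _).trans (hc 0); simpa using this
  set R : ℝ := |q| + 1 with hR
  have hR0 : 0 ≤ R := by positivity
  have hu : Summable fun k : ℕ => M * ((k : ℝ) / (k.factorial : ℝ) * R ^ (k - 1)) := by
    refine Summable.mul_left M ?_
    rw [← summable_nat_add_iff 1]
    refine (Real.summable_pow_div_factorial R).congr fun k => ?_
    have : ((k : ℝ) + 1) ≠ 0 := by positivity
    rw [Nat.factorial_succ]
    push_cast
    field_simp
  have hd := hasDerivAt_tsum_of_isPreconnected (𝕜 := ℝ) (F := ℝ)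
    (g := fun (k : ℕ) (y : ℝ) => c k * y ^ k)
    (g' := fun (k : ℕ) (y : ℝ) => c k * ((k : ℝ) * y ^ (k - 1))) (t := Metric.ball 0 R)
    (y₀ := 0) (y := q) hu Metric.isOpen_ball (convex_ball (0 : ℝ) R).isPreconnected
    (fun k y _ => (hasDerivAt_pow k y).const_mul (c k))
    (fun k y hy => by
      have hy' : |y| ≤ R := by
        rw [Metric.mem_ball, dist_zero_right, Real.norm_eq_abs] at hy
        exact hy.le
      rw [Real.norm_eq_abs, abs_mul, abs_mul, abs_pow, Nat.abs_cast]
      calc |c k| * ((k : ℝ) * |y| ^ (k - 1))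
          ≤ M / (k.factorial : ℝ) * ((k : ℝ) * R ^ (k - 1)) := by
            gcongr
            exact hc k
        _ = _ := by ring)
    (by rw [Metric.mem_ball, dist_self]; positivity) (powSum_summable hc 0)
    (by rw [Metric.mem_ball, dist_zero_right, Real.norm_eq_abs]; linarith)
  change HasDerivAt (fun z => ∑' k, c k * z ^ k) _ _
  refine hd.congr_deriv ?_
  unfold powSum
  have hs : Summable fun k : ℕ => c k * ((k : ℝ) * q ^ (k - 1)) := by
    refine Summable.of_norm_bounded hu fun k => ?_
    rw [Real.norm_eq_abs, abs_mul, abs_mul, abs_pow, Nat.abs_cast]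
    calc |c k| * ((k : ℝ) * |q| ^ (k - 1))
        ≤ M / (k.factorial : ℝ) * ((k : ℝ) * R ^ (k - 1)) := by
          gcongr
          · exact hc k
          · linarith
      _ = _ := by ring
  rw [hs.tsum_eq_zero_add]
  simp only [Nat.cast_zero, zero_mul, mul_zero, zero_add, Nat.add_sub_cancel]
  congr 1
  funext k
  push_cast
  ring

/-! ### Coefficients of the Bessel and Neumann series. -/

/-- The coefficients `(-1)^k / (k! (n+k)!)`. -/
noncomputable def besselJCoeff (n k : ℕ) : ℝ :=
  (-1) ^ k / ((k.factorial : ℝ) * ((n + k).factorial : ℝ))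

/-- The coefficients `(-1)^k / (k! (n+k)!) (H_{n+k} + H_k)`. -/
noncomputable def besselHCoeff (n k : ℕ) : ℝ :=
  besselJCoeff n k * ((harmonic (n + k) : ℝ) + (harmonic k : ℝ))

theorem harmonic_cast_succ (n : ℕ) :
    ((harmonic (n + 1) : ℚ) : ℝ) = (harmonic n : ℝ) + 1 / ((n : ℝ) + 1) := by
  rw [harmonic_succ]; push_cast; ring

theorem harmonic_cast_nonneg (n : ℕ) : (0 : ℝ) ≤ (harmonic n : ℝ) := by
  induction n with
  | zero => simp
  | succ n ih => rw [harmonic_cast_succ]; positivity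

theorem harmonic_cast_le (n : ℕ) : ((harmonic n : ℚ) : ℝ) ≤ n := by
  induction n with
  | zero => simp
  | succ n ih =>
    rw [harmonic_cast_succ]
    push_cast
    have : 1 / ((n : ℝ) + 1) ≤ 1 := by
      rw [div_le_one (by positivity)]
      linarith [(Nat.cast_nonneg n : (0 : ℝ) ≤ n)]
    linarith

theorem abs_besselJCoeff (n k : ℕ) :
    |besselJCoeff n k| = 1 / ((k.factorial : ℝ) * ((n + k).factorial : ℝ)) := by
  unfold besselJCoeff
  rw [abs_div, abs_pow, abs_neg, abs_one, one_pow, abs_of_pos (by positivity)]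

theorem abs_besselJCoeff_le (n k : ℕ) : |besselJCoeff n k| ≤ 1 / (k.factorial : ℝ) := by
  rw [abs_besselJCoeff]
  apply one_div_le_one_div_of_le (by positivity)
  have : (1 : ℝ) ≤ ((n + k).factorial : ℝ) := by exact_mod_cast Nat.one_le_iff_ne_zero.2 (Nat.factorial_ne_zero _)
  nlinarith [(Nat.cast_nonneg k.factorial : (0 : ℝ) ≤ k.factorial)]

theorem abs_besselHCoeff_le (n k : ℕ) : |besselHCoeff n k| ≤ 2 / (k.factorial : ℝ) := by
  unfold besselHCoeff
  rw [abs_mul, abs_besselJCoeff, abs_of_nonneg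
    (add_nonneg (harmonic_cast_nonneg _) (harmonic_cast_nonneg _))]
  have h1 : ((harmonic (n + k) : ℚ) : ℝ) + (harmonic k : ℝ) ≤ 2 * ((n + k).factorial : ℝ) := by
    have a := harmonic_cast_le (n + k)
    have b := harmonic_cast_le k
    have c : ((n + k : ℕ) : ℝ) ≤ ((n + k).factorial : ℝ) := by
      exact_mod_cast Nat.self_le_factorial (n + k)
    have d : (k : ℝ) ≤ ((n + k : ℕ) : ℝ) := by exact_mod_cast Nat.le_add_left k n
    linarith
  calc _ ≤ 1 / ((k.factorial : ℝ) * ((n + k).factorial : ℝ)) * (2 * ((n + k).factorial : ℝ)) := by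
        gcongr
    _ = _ := by
      have := Nat.factorial_ne_zero k
      have := Nat.factorial_ne_zero (n + k)
      field_simp

theorem besselJCoeff_zero_right (n : ℕ) :
    besselJCoeff n 0 = ((n : ℝ) + 1) * besselJCoeff (n + 1) 0 := by
  unfold besselJCoeff
  simp only [add_zero, Nat.factorial_succ]
  push_cast
  field_simp

theorem besselJCoeff_recurrence (n k : ℕ) :
    besselJCoeff n (k + 1) + besselJCoeff (n + 2) k
      = ((n : ℝ) + 1) * besselJCoeff (n + 1) (k + 1) := by
  unfold besselJCoeff
  rw [show n + (k + 1) = n + k + 1 by ring, show n + 2 + k = n + k + 1 + 1 by ring,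
    show n + 1 + (k + 1) = n + k + 1 + 1 by ring]
  simp only [Nat.factorial_succ, pow_succ]
  push_cast
  field_simp
  ring

/-- The defect `1/(n+1)!` comes from `H_{n+1} - H_n = 1/(n+1)`; it later cancels the surplus in
`besselPrincipal_recurrence`. At higher indices the two harmonic increments cancel each other. -/
theorem besselHCoeff_zero_right (n : ℕ) :
    besselHCoeff n 0
      = ((n : ℝ) + 1) * besselHCoeff (n + 1) 0 - 1 / ((n + 1).factorial : ℝ) := by
  unfold besselHCoeff besselJCoeff
  simp only [add_zero, Nat.factorial_succ, harmonic_cast_succ]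
  push_cast
  simp only [harmonic_zero, Rat.cast_zero]
  field_simp
  ring

theorem besselHCoeff_recurrence (n k : ℕ) :
    besselHCoeff n (k + 1) + besselHCoeff (n + 2) k
      = ((n : ℝ) + 1) * besselHCoeff (n + 1) (k + 1) := by
  unfold besselHCoeff besselJCoeff
  rw [show n + (k + 1) = n + k + 1 by ring, show n + 2 + k = n + k + 1 + 1 by ring,
    show n + 1 + (k + 1) = n + k + 1 + 1 by ring]
  simp only [Nat.factorial_succ, pow_succ, harmonic_cast_succ]
  push_cast
  field_simp
  ring

/-- Comparison of coefficients. The factor `q` shifts `b` by one, so the constant terms are matched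
separately and `s` records their defect. -/
theorem powSum_three_term {a b c : ℕ → ℝ} {Ma Mb Mc r s : ℝ}
    (ha : ∀ k : ℕ, |a k| ≤ Ma / (k.factorial : ℝ)) (hb : ∀ k : ℕ, |b k| ≤ Mb / (k.factorial : ℝ))
    (hc : ∀ k : ℕ, |c k| ≤ Mc / (k.factorial : ℝ)) (h0 : a 0 = r * c 0 - s)
    (h : ∀ k, a (k + 1) + b k = r * c (k + 1)) (q : ℝ) :
    powSum a q + q * powSum b q = r * powSum c q - s := by
  have e : ∀ (d : ℕ → ℝ) (M : ℝ), (∀ k : ℕ, |d k| ≤ M / (k.factorial : ℝ)) →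
      HasSum (fun k => d (k + 1) * q ^ (k + 1)) (powSum d q - d 0) := fun d M hd => by
    have := (hasSum_nat_add_iff' 1).2 (powSum_summable hd q).hasSum
    simpa [powSum] using this
  have h1 := (e a Ma ha).add ((powSum_summable hb q).hasSum.mul_left q)
  have h2 := (e c Mc hc).mul_left r
  have h3 := h1.unique (h2.congr_fun fun k => by
    linear_combination q ^ (k + 1) * h k)
  change powSum a q - a 0 + q * powSum b q = _ at h3
  linarith

/-! ### The series for `Y_n` in the variable `q = (z/2)^2` and its recurrence. -/

/-- The entire part of `J_n(z) (z/2)^(-n)` as a function of `q = (z/2)^2`. -/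
noncomputable def besselJSeries (n : ℕ) (q : ℝ) : ℝ := powSum (besselJCoeff n) q

/-- The harmonic series in `Y_n(z)`, as a function of `q = (z/2)^2`. -/
noncomputable def besselHSeries (n : ℕ) (q : ℝ) : ℝ := powSum (besselHCoeff n) q

/-- The principal part of `-π Y_n(z) (z/2)^n`, as a function of `q = (z/2)^2`. -/
noncomputable def besselPrincipal (n : ℕ) (q : ℝ) : ℝ :=
  ∑ k ∈ Finset.range n, ((n - 1 - k).factorial : ℝ) / (k.factorial : ℝ) * q ^ k

/-- The function `-π Y_n(z) (z/2)^n` in the variable `q = (z/2)^2`. -/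
noncomputable def neumannW (n : ℕ) (q : ℝ) : ℝ :=
  besselPrincipal n q
    + q ^ n * (besselHSeries n q
      - (Real.log q + 2 * Real.eulerMascheroniConstant) * besselJSeries n q)

theorem besselJSeries_recurrence (n : ℕ) (q : ℝ) :
    besselJSeries n q + q * besselJSeries (n + 2) q = ((n : ℝ) + 1) * besselJSeries (n + 1) q := by
  have := powSum_three_term (s := 0) (abs_besselJCoeff_le n) (abs_besselJCoeff_le (n + 2))
    (abs_besselJCoeff_le (n + 1)) (by rw [besselJCoeff_zero_right, sub_zero])
    (besselJCoeff_recurrence n) q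
  rwa [sub_zero] at this

theorem besselHSeries_recurrence (n : ℕ) (q : ℝ) :
    besselHSeries n q + q * besselHSeries (n + 2) q
      = ((n : ℝ) + 1) * besselHSeries (n + 1) q - 1 / ((n + 1).factorial : ℝ) :=
  powSum_three_term (abs_besselHCoeff_le n) (abs_besselHCoeff_le (n + 2))
    (abs_besselHCoeff_le (n + 1)) (besselHCoeff_zero_right n) (besselHCoeff_recurrence n) q

theorem besselPrincipal_recurrence (n : ℕ) (q : ℝ) :
    besselPrincipal (n + 2) q + q * besselPrincipal n q
      = ((n : ℝ) + 1) * besselPrincipal (n + 1) q + q ^ (n + 1) / ((n + 1).factorial : ℝ) := by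
  unfold besselPrincipal
  rw [Finset.sum_range_succ, Finset.sum_range_succ', Finset.sum_range_succ' _ n, Finset.mul_sum,
    mul_add, Finset.mul_sum]
  have : ∀ k ∈ Finset.range n,
      ((n + 2 - 1 - (k + 1)).factorial : ℝ) / ((k + 1).factorial : ℝ) * q ^ (k + 1)
        = ((n : ℝ) + 1)
            * (((n + 1 - 1 - (k + 1)).factorial : ℝ) / ((k + 1).factorial : ℝ) * q ^ (k + 1))
          - q * (((n - 1 - k).factorial : ℝ) / (k.factorial : ℝ) * q ^ k) := by
    intro k hk
    obtain ⟨m, rfl⟩ := Nat.exists_eq_add_of_lt (Finset.mem_range.1 hk)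
    rw [show k + m + 1 + 2 - 1 - (k + 1) = m + 1 by omega,
      show k + m + 1 + 1 - 1 - (k + 1) = m by omega, show k + m + 1 - 1 - k = m by omega]
    simp only [Nat.factorial_succ]
    push_cast
    field_simp
    ring
  rw [Finset.sum_congr rfl this, Finset.sum_sub_distrib]
  rw [show n + 2 - 1 - 0 = n + 1 by omega, show n + 1 - 1 - 0 = n by omega,
    show n + 2 - 1 - (n + 1) = 0 by omega]
  simp only [Nat.factorial_succ, Nat.factorial_zero]
  push_cast
  ring

theorem neumannW_recurrence (n : ℕ) (q : ℝ) :
    neumannW (n + 2) q + q * neumannW n q = ((n : ℝ) + 1) * neumannW (n + 1) q := by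
  unfold neumannW
  have h1 := besselJSeries_recurrence n q
  have h2 := besselHSeries_recurrence n q
  have h3 := besselPrincipal_recurrence n q
  linear_combination h3 + q ^ (n + 1) * h2
    - q ^ (n + 1) * (Real.log q + 2 * Real.eulerMascheroniConstant) * h1

theorem besselY_eq_neumannW (n : ℕ) {z : ℝ} (hz : 0 < z) :
    besselY n z = -(neumannW n ((z / 2) ^ 2) / ((z / 2) ^ n * Real.pi)) := by
  have hx : z / 2 ≠ 0 := by positivity
  have hJ : besselJ n z = (z / 2) ^ n * besselJSeries n ((z / 2) ^ 2) := by
    unfold besselJ besselJSeries powSum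
    rw [← tsum_mul_left]
    refine tsum_congr fun k => ?_
    rw [besselJCoeff, ← pow_mul, pow_add]
    ring
  have hH : (∑' k : ℕ, (-1) ^ k / ((k.factorial : ℝ) * ((n + k).factorial : ℝ))
      * ((harmonic (n + k) : ℝ) + (harmonic k : ℝ)) * (z / 2) ^ (n + 2 * k))
      = (z / 2) ^ n * besselHSeries n ((z / 2) ^ 2) := by
    unfold besselHSeries powSum
    rw [← tsum_mul_left]
    refine tsum_congr fun k => ?_
    rw [besselHCoeff, besselJCoeff, ← pow_mul, pow_add]
    ring
  have hP : (∑ k ∈ Finset.range n,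
      ((n - 1 - k).factorial : ℝ) / (k.factorial : ℝ) * (2 / z) ^ ((n : ℤ) - 2 * (k : ℤ)))
      = besselPrincipal n ((z / 2) ^ 2) / (z / 2) ^ n := by
    unfold besselPrincipal
    rw [Finset.sum_div]
    refine Finset.sum_congr rfl fun k _ => ?_
    rw [mul_div_assoc]
    congr 1
    rw [← inv_div, inv_zpow', neg_sub, zpow_sub₀ hx, ← pow_mul]
    norm_cast
  unfold besselY
  rw [hJ, hH, hP, neumannW, Real.log_pow]
  generalize z / 2 = x at *
  push_cast
  field_simp
  ring

theorem neumannC_eq_neumannW (n : ℕ) {z : ℝ} (hz : 0 < z) :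
    neumannC (n + 1) z = neumannW (n + 1) ((z / 2) ^ 2) / (n.factorial : ℝ) := by
  unfold neumannC
  rw [besselY_eq_neumannW _ hz]
  push_cast
  rw [Real.Gamma_nat_eq_factorial]
  have := Real.pi_ne_zero
  field_simp

/-! ### Differential system satisfied by the series of orders `0` and `1`. -/

theorem hasDerivAt_besselJSeries_zero (q : ℝ) :
    HasDerivAt (besselJSeries 0) (-besselJSeries 1 q) q := by
  refine (hasDerivAt_powSum (abs_besselJCoeff_le 0) q).congr_deriv ?_
  unfold besselJSeries powSum
  rw [← tsum_neg]
  refine tsum_congr fun k => ?_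
  simp only [besselJCoeff, zero_add, add_comm 1 k]
  simp only [Nat.factorial_succ]
  push_cast
  field_simp
  ring

theorem hasDerivAt_besselHSeries_zero {q : ℝ} (hq : q ≠ 0) :
    HasDerivAt (besselHSeries 0) (-besselHSeries 1 q + (besselJSeries 0 q - 1) / q) q := by
  refine (hasDerivAt_powSum (abs_besselHCoeff_le 0) q).congr_deriv ?_
  have h : (besselJSeries 0 q - 1) / q = powSum (fun k => besselJCoeff 0 (k + 1)) q := by
    rw [besselJSeries, powSum_eq_add (abs_besselJCoeff_le 0)]
    simp [besselJCoeff, hq]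
  have hs : Summable fun k => besselJCoeff 0 (k + 1) * q ^ k := by
    refine powSum_summable (M := 1) (fun k => (abs_besselJCoeff_le 0 (k + 1)).trans ?_) q
    gcongr
    omega
  rw [h, neg_add_eq_sub]
  unfold besselHSeries powSum
  rw [← hs.tsum_sub (powSum_summable (abs_besselHCoeff_le 1) q)]
  refine tsum_congr fun k => ?_
  simp only [besselHCoeff, besselJCoeff, zero_add, add_comm 1 k]
  simp only [Nat.factorial_succ, harmonic_cast_succ, pow_succ]
  push_cast
  field_simp
  ring

theorem hasDerivAt_mul_powSum {c : ℕ → ℝ} {M : ℝ} (hc : ∀ k : ℕ, |c k| ≤ M / (k.factorial : ℝ))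
    (q : ℝ) :
    HasDerivAt (fun x => x * powSum c x) (powSum (fun k : ℕ => ((k : ℝ) + 1) * c k) q) q := by
  have hM : 0 ≤ M := by have := (abs_nonneg _).trans (hc 0); simpa using this
  refine ((hasDerivAt_id q).mul (hasDerivAt_powSum hc q)).congr_deriv ?_
  have h1 : ∀ k : ℕ, |(k : ℝ) * c k| ≤ M * (k : ℝ) / (k.factorial : ℝ) := fun k => by
    rw [abs_mul, Nat.abs_cast, mul_comm M, mul_div_assoc]
    exact mul_le_mul_of_nonneg_left (hc k) (Nat.cast_nonneg k)
  have hs : Summable fun k : ℕ => ((k : ℝ) + 1) * c (k + 1) * q ^ k := by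
    refine powSum_summable (M := M) (fun k => ?_) q
    rw [abs_mul, abs_of_nonneg (by positivity)]
    refine (mul_le_mul_of_nonneg_left (hc (k + 1)) (by positivity)).trans_eq ?_
    rw [Nat.factorial_succ]
    push_cast
    field_simp
  have h2 := (hs.hasSum.mul_left q)
  have h3 : HasSum (fun k : ℕ => (k : ℝ) * c k * q ^ k)
      (q * powSum (fun k : ℕ => ((k : ℝ) + 1) * c (k + 1)) q) := by
    rw [← hasSum_nat_add_iff' 1]
    simp only [Finset.sum_range_one, Nat.cast_zero, zero_mul, sub_zero]
    refine h2.congr_fun fun k => ?_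
    push_cast
    ring
  have h4 := ((powSum_summable hc q).hasSum.add h3).tsum_eq
  simp only [id, one_mul]
  change _ = powSum c q + _ at h4
  rw [← h4]
  unfold powSum
  refine tsum_congr fun k => ?_
  ring

theorem hasDerivAt_mul_besselJSeries_one (q : ℝ) :
    HasDerivAt (fun x => x * besselJSeries 1 x) (besselJSeries 0 q) q := by
  refine (hasDerivAt_mul_powSum (abs_besselJCoeff_le 1) q).congr_deriv ?_
  unfold besselJSeries powSum
  refine tsum_congr fun k => ?_
  simp only [besselJCoeff, zero_add, add_comm 1 k, Nat.factorial_succ]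
  push_cast
  field_simp

theorem hasDerivAt_mul_besselHSeries_one (q : ℝ) :
    HasDerivAt (fun x => x * besselHSeries 1 x) (besselHSeries 0 q + besselJSeries 1 q) q := by
  refine (hasDerivAt_mul_powSum (abs_besselHCoeff_le 1) q).congr_deriv ?_
  unfold besselHSeries besselJSeries powSum
  rw [← (powSum_summable (abs_besselHCoeff_le 0) q).tsum_add
    (powSum_summable (abs_besselJCoeff_le 1) q)]
  refine tsum_congr fun k => ?_
  simp only [besselHCoeff, besselJCoeff, zero_add, add_comm 1 k]
  simp only [Nat.factorial_succ, harmonic_cast_succ]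
  push_cast
  field_simp
  ring

/-- Differentiating the logarithm gives `-J/q` with `J = besselJSeries 0 q`, and the harmonic series
contributes `(J - 1)/q`. What remains, `-1/q`, accounts for the principal part of order `1`. -/
theorem hasDerivAt_neumannW_zero {q : ℝ} (hq : 0 < q) :
    HasDerivAt (neumannW 0) (-neumannW 1 q / q) q := by
  have h := (hasDerivAt_besselHSeries_zero hq.ne').sub
    (((Real.hasDerivAt_log hq.ne').add_const (2 * Real.eulerMascheroniConstant)).mul
      (hasDerivAt_besselJSeries_zero q))
  have e : neumannW 0 = fun x => besselHSeries 0 x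
      - (Real.log x + 2 * Real.eulerMascheroniConstant) * besselJSeries 0 x := by
    funext x; simp [neumannW, besselPrincipal]
  rw [e]
  refine h.congr_deriv ?_
  simp only [neumannW, besselPrincipal, Finset.sum_range_one]
  simp
  field_simp
  ring

theorem hasDerivAt_neumannW_one {q : ℝ} (hq : 0 < q) :
    HasDerivAt (neumannW 1) (neumannW 0 q) q := by
  have h := ((hasDerivAt_mul_besselHSeries_one q).sub
    (((Real.hasDerivAt_log hq.ne').add_const (2 * Real.eulerMascheroniConstant)).mul
      (hasDerivAt_mul_besselJSeries_one q))).const_add 1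
  have e : neumannW 1 = fun x => 1 + (x * besselHSeries 1 x
      - (Real.log x + 2 * Real.eulerMascheroniConstant) * (x * besselJSeries 1 x)) := by
    funext x; simp [neumannW, besselPrincipal]; ring
  rw [e]
  refine h.congr_deriv ?_
  simp [neumannW, besselPrincipal]
  field_simp
  ring

/-! ### Behaviour of the series at the origin. -/

theorem continuous_powSum {c : ℕ → ℝ} {M : ℝ} (hc : ∀ k : ℕ, |c k| ≤ M / (k.factorial : ℝ)) :
    Continuous (powSum c) :=
  continuous_iff_continuousAt.2 fun q => (hasDerivAt_powSum hc q).continuousAt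

theorem continuous_besselJSeries (n : ℕ) : Continuous (besselJSeries n) :=
  continuous_powSum (abs_besselJCoeff_le n)

theorem continuous_besselHSeries (n : ℕ) : Continuous (besselHSeries n) :=
  continuous_powSum (abs_besselHCoeff_le n)

/-- One factor of `q ^ (n + 1)` is spent on the logarithm: `q log q` is continuous on the whole
line, including at `0`. -/
theorem continuous_neumannW_succ (n : ℕ) : Continuous (neumannW (n + 1)) := by
  have e : neumannW (n + 1) = fun q => besselPrincipal (n + 1) q
      + q ^ n * (q * besselHSeries (n + 1) q
        - (q * Real.log q + 2 * Real.eulerMascheroniConstant * q) * besselJSeries (n + 1) q) := by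
    funext q
    rw [neumannW]
    ring
  rw [e]
  have h1 := continuous_besselJSeries (n + 1)
  have h2 := continuous_besselHSeries (n + 1)
  have h3 := Real.continuous_mul_log
  have h4 : Continuous (besselPrincipal (n + 1)) := by
    unfold besselPrincipal
    fun_prop
  fun_prop

theorem neumannW_succ_zero (n : ℕ) : neumannW (n + 1) 0 = (n.factorial : ℝ) := by
  simp [neumannW, besselPrincipal, Finset.sum_range_succ']

theorem tendsto_neumannW_succ (n : ℕ) :
    Tendsto (neumannW (n + 1)) (𝓝 0) (𝓝 (n.factorial : ℝ)) := by
  rw [← neumannW_succ_zero n]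
  exact (continuous_neumannW_succ n).tendsto 0

theorem tendsto_neumannC_nhdsGT_zero (n : ℕ) :
    Tendsto (fun z : ℝ => neumannC (n + 1) z) (𝓝[>] 0) (𝓝 1) := by
  have h1 : Tendsto (fun z : ℝ => (z / 2) ^ 2) (𝓝[>] 0) (𝓝 0) := by
    have : Continuous fun z : ℝ => (z / 2) ^ 2 := by fun_prop
    have h := this.tendsto 0
    norm_num at h
    exact h.mono_left nhdsWithin_le_nhds
  have h2 := ((tendsto_neumannW_succ n).comp h1).div_const (n.factorial : ℝ)
  rw [div_self (by positivity)] at h2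
  refine h2.congr' ?_
  filter_upwards [self_mem_nhdsWithin] with z hz
  exact (neumannC_eq_neumannW n hz).symm

theorem tendsto_neumannW_zero_add_log :
    Tendsto (fun q => neumannW 0 q + (Real.log q + 2 * Real.eulerMascheroniConstant)) (𝓝 0)
      (𝓝 0) := by
  have hc : ∀ k : ℕ, |besselJCoeff 0 (k + 1)| ≤ 1 / (k.factorial : ℝ) := fun k =>
    (abs_besselJCoeff_le 0 (k + 1)).trans (by gcongr; omega)
  have e : (fun q => neumannW 0 q + (Real.log q + 2 * Real.eulerMascheroniConstant))
      = fun q => besselHSeries 0 q - (q * Real.log q + 2 * Real.eulerMascheroniConstant * q)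
          * powSum (fun k => besselJCoeff 0 (k + 1)) q := by
    funext q
    have : besselJSeries 0 q = 1 + q * powSum (fun k => besselJCoeff 0 (k + 1)) q := by
      rw [besselJSeries, powSum_eq_add (abs_besselJCoeff_le 0)]
      simp [besselJCoeff]
    rw [neumannW, this]
    simp [besselPrincipal]
    ring
  rw [e]
  have h1 := continuous_powSum hc
  have h2 := continuous_besselHSeries 0
  have h3 := Real.continuous_mul_log
  have h4 : Continuous (fun q => besselHSeries 0 q
      - (q * Real.log q + 2 * Real.eulerMascheroniConstant * q)
          * powSum (fun k => besselJCoeff 0 (k + 1)) q) := by fun_prop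
  have h5 := h4.tendsto 0
  have h6 : besselHSeries 0 0 = 0 := by
    rw [besselHSeries, powSum_zero (abs_besselHCoeff_le 0)]
    simp [besselHCoeff]
  simpa [h6] using h5

theorem tendsto_neumannW_one_sub_div :
    Tendsto (fun x : ℝ => (neumannW 1 (x ^ 2) - 1) / x) (𝓝[>] 0) (𝓝 0) := by
  have h1 := continuous_besselJSeries 1
  have h2 := continuous_besselHSeries 1
  have h3 := Real.continuous_mul_log
  have h4 : Continuous (fun x : ℝ => x * besselHSeries 1 (x ^ 2)
      - 2 * (x * Real.log x + Real.eulerMascheroniConstant * x) * besselJSeries 1 (x ^ 2)) := by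
    fun_prop
  have h5 := h4.tendsto 0
  simp only [zero_mul, mul_zero, add_zero, sub_zero] at h5
  refine (h5.mono_left nhdsWithin_le_nhds).congr' ?_
  filter_upwards [self_mem_nhdsWithin] with x hx
  have hx' : x ≠ 0 := (Set.mem_Ioi.1 hx).ne'
  rw [neumannW, Real.log_pow]
  simp [besselPrincipal]
  field_simp

/-! ### The limit as the order tends to infinity. -/

/-- The term `k = 0` is exactly `1`. In the others `(n-k)!/(n+1)! ≤ 1/(n+1)`, and what is left is
part of the exponential series. -/
theorem abs_besselPrincipal_sub_le (n : ℕ) {q : ℝ} (hq : 0 ≤ q) :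
    |besselPrincipal (n + 2) q / ((n + 1).factorial : ℝ) - 1|
      ≤ Real.exp q * (1 / ((n : ℝ) + 1)) := by
  have e : besselPrincipal (n + 2) q / ((n + 1).factorial : ℝ) - 1
      = ∑ k ∈ Finset.range (n + 1),
          ((n - k).factorial : ℝ) / ((n + 1).factorial : ℝ)
            * (q ^ (k + 1) / ((k + 1).factorial : ℝ)) := by
    have h0 : ((n + 1).factorial : ℝ) ≠ 0 := by positivity
    rw [besselPrincipal, Finset.sum_range_succ', add_div, Finset.sum_div]
    simp only [pow_zero, Nat.factorial_zero, Nat.cast_one, div_one, mul_one, Nat.sub_zero]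
    rw [show n + 2 - 1 = n + 1 by omega, div_self h0, add_sub_cancel_right]
    refine Finset.sum_congr rfl fun k _ => ?_
    rw [show n + 1 - (k + 1) = n - k by omega]
    ring
  rw [e, abs_of_nonneg (Finset.sum_nonneg fun k _ => by positivity)]
  have h1 : ∀ k ∈ Finset.range (n + 1), ((n - k).factorial : ℝ) / ((n + 1).factorial : ℝ)
      * (q ^ (k + 1) / ((k + 1).factorial : ℝ))
        ≤ q ^ (k + 1) / ((k + 1).factorial : ℝ) * (1 / ((n : ℝ) + 1)) := by
    intro k _
    rw [mul_comm]
    refine mul_le_mul_of_nonneg_left ?_ (by positivity)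
    rw [div_le_div_iff₀ (by positivity) (by positivity), one_mul, Nat.factorial_succ, mul_comm]
    push_cast
    gcongr
    omega
  refine (Finset.sum_le_sum h1).trans ?_
  rw [← Finset.sum_mul]
  gcongr
  have h2 := Real.sum_le_exp_of_nonneg hq (n + 2)
  rw [Finset.sum_range_succ'] at h2
  refine le_trans ?_ h2
  simp

theorem tendsto_neumannC_atTop {z : ℝ} (hz : 0 < z) :
    Tendsto (fun n : ℕ => neumannC n z) atTop (𝓝 1) := by
  rw [← tendsto_add_atTop_iff_nat 2]
  set q := (z / 2) ^ 2 with hq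
  have hq0 : 0 ≤ q := by positivity
  have e : ∀ n : ℕ, neumannC (n + 2) z = 1
      + (besselPrincipal (n + 2) q / ((n + 1).factorial : ℝ) - 1)
      + q * (q ^ (n + 1) / ((n + 1).factorial : ℝ)) * (besselHSeries (n + 2) q
        - (Real.log q + 2 * Real.eulerMascheroniConstant) * besselJSeries (n + 2) q) := by
    intro n
    rw [neumannC_eq_neumannW (n + 1) hz, neumannW]
    ring
  simp_rw [e]
  have h1 : Tendsto (fun n : ℕ => besselPrincipal (n + 2) q / ((n + 1).factorial : ℝ) - 1) atTop
      (𝓝 0) := by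
    refine squeeze_zero_norm (fun n => abs_besselPrincipal_sub_le n hq0) ?_
    simpa using tendsto_one_div_add_atTop_nhds_zero_nat.const_mul (Real.exp q)
  have h2 : Tendsto (fun n : ℕ => q ^ (n + 1) / ((n + 1).factorial : ℝ)) atTop (𝓝 0) :=
    (tendsto_add_atTop_iff_nat 1).2 (FloorSemiring.tendsto_pow_div_factorial_atTop q)
  set L := |Real.log q + 2 * Real.eulerMascheroniConstant|
  have h3 : Tendsto (fun n : ℕ => q * (q ^ (n + 1) / ((n + 1).factorial : ℝ))
      * (besselHSeries (n + 2) q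
        - (Real.log q + 2 * Real.eulerMascheroniConstant) * besselJSeries (n + 2) q)) atTop
      (𝓝 0) := by
    -- The coefficient bounds `1/k!` and `2/k!` are uniform in the order, so the bracket is bounded
    -- independently of `n`.
    refine squeeze_zero_norm (a := fun n : ℕ => q * (q ^ (n + 1) / ((n + 1).factorial : ℝ))
      * (2 * Real.exp |q| + L * (1 * Real.exp |q|))) (fun n => ?_) ?_
    · rw [Real.norm_eq_abs, abs_mul, abs_of_nonneg (a := q * _) (by positivity)]
      gcongr
      refine (abs_sub _ _).trans (add_le_add (abs_powSum_le (abs_besselHCoeff_le _) q) ?_)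
      rw [abs_mul]
      gcongr
      exact abs_powSum_le (abs_besselJCoeff_le _) q
    · simpa using (h2.const_mul q).mul_const (2 * Real.exp |q| + L * (1 * Real.exp |q|))
  simpa using (h1.const_add 1).add h3

/-! ### Schläfli integrals: derivatives, recurrences and signs. -/

/-- The trigonometric part of the Schläfli integral. -/
noncomputable def schlafliSin (ν z : ℝ) : ℝ :=
  ∫ θ in (0 : ℝ)..Real.pi, Real.sin (z * Real.sin θ - ν * θ)

/-- The exponential part of the Schläfli integral. -/
noncomputable def schlafliExp (ν z : ℝ) : ℝ :=
  ∫ t in Set.Ioi (0 : ℝ), Real.exp (ν * t - z * Real.sinh t)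

theorem hasDerivAt_schlafliSin (ν z : ℝ) :
    HasDerivAt (schlafliSin ν) ((schlafliSin (ν - 1) z - schlafliSin (ν + 1) z) / 2) z := by
  have h := intervalIntegral.hasDerivAt_integral_of_dominated_loc_of_deriv_le
    (μ := volume) (a := 0) (b := Real.pi)
    (F := fun z θ => Real.sin (z * Real.sin θ - ν * θ))
    (F' := fun z θ => Real.cos (z * Real.sin θ - ν * θ) * Real.sin θ) (x₀ := z)
    (bound := fun _ => 1) (s := Set.univ) Filter.univ_mem
    (Eventually.of_forall fun x => (by fun_prop : Continuous
      fun θ => Real.sin (x * Real.sin θ - ν * θ)).aestronglyMeasurable)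
    ((by fun_prop : Continuous fun θ => Real.sin (z * Real.sin θ - ν * θ)).intervalIntegrable _ _)
    (by fun_prop : Continuous
      fun θ => Real.cos (z * Real.sin θ - ν * θ) * Real.sin θ).aestronglyMeasurable
    (Eventually.of_forall fun θ _ x _ => by
      rw [Real.norm_eq_abs, abs_mul]
      exact mul_le_one₀ (Real.abs_cos_le_one _) (abs_nonneg _) (Real.abs_sin_le_one _))
    intervalIntegrable_const
    (Eventually.of_forall fun θ _ x _ => by
      have := (((hasDerivAt_id x).mul_const (Real.sin θ)).sub_const (ν * θ)).sin
      simpa using this)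
  refine h.2.congr_deriv ?_
  unfold schlafliSin
  rw [← intervalIntegral.integral_sub
    ((by fun_prop : Continuous _).intervalIntegrable _ _)
    ((by fun_prop : Continuous _).intervalIntegrable _ _), ← intervalIntegral.integral_div]
  refine intervalIntegral.integral_congr fun θ _ => ?_
  rw [show z * Real.sin θ - (ν - 1) * θ = z * Real.sin θ - ν * θ + θ by ring,
    show z * Real.sin θ - (ν + 1) * θ = z * Real.sin θ - ν * θ - θ by ring,
    Real.sin_add _ θ, Real.sin_sub (z * Real.sin θ - ν * θ) θ]
  ring

/-- Integrate the `θ`-derivative of `cos(z sin θ - nθ)` over `[0, π]`. Integrality of `n` evaluates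
the endpoint as `(-1)^n`. -/
theorem schlafliSin_recurrence (n : ℕ) (z : ℝ) :
    z * (schlafliSin (n - 1) z + schlafliSin (n + 1) z)
      = 2 * n * schlafliSin n z + 2 * (1 - (-1) ^ n) := by
  have h := intervalIntegral.integral_eq_sub_of_hasDerivAt (a := 0) (b := Real.pi)
    (f := fun θ => Real.cos (z * Real.sin θ - n * θ))
    (f' := fun θ => -Real.sin (z * Real.sin θ - n * θ) * (z * Real.cos θ - n))
    (fun θ _ => by
      have := (((Real.hasDerivAt_sin θ).const_mul z).sub ((hasDerivAt_id θ).const_mul (n : ℝ))).cos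
      simpa using this)
    ((by fun_prop : Continuous _).intervalIntegrable _ _)
  have e : (Real.cos (z * Real.sin Real.pi - n * Real.pi)) = (-1) ^ n := by
    rw [Real.sin_pi, mul_zero, zero_sub, Real.cos_neg, Real.cos_nat_mul_pi]
  have e0 : Real.cos (z * Real.sin 0 - n * 0) = 1 := by simp
  rw [e, e0] at h
  have h2 : z * (schlafliSin (n - 1) z + schlafliSin (n + 1) z) - 2 * n * schlafliSin n z
      = -2 * ∫ θ in (0 : ℝ)..Real.pi,
          -Real.sin (z * Real.sin θ - n * θ) * (z * Real.cos θ - n) := by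
    unfold schlafliSin
    rw [← intervalIntegral.integral_add
      ((by fun_prop : Continuous _).intervalIntegrable _ _)
      ((by fun_prop : Continuous _).intervalIntegrable _ _), ← intervalIntegral.integral_const_mul,
      ← intervalIntegral.integral_const_mul, ← intervalIntegral.integral_const_mul,
      ← intervalIntegral.integral_sub
      ((by fun_prop : Continuous _).intervalIntegrable _ _)
      ((by fun_prop : Continuous _).intervalIntegrable _ _)]
    refine intervalIntegral.integral_congr fun θ _ => ?_
    rw [show z * Real.sin θ - (n - 1) * θ = z * Real.sin θ - n * θ + θ by ring,
      show z * Real.sin θ - (n + 1) * θ = z * Real.sin θ - n * θ - θ by ring,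
      Real.sin_add _ θ, Real.sin_sub (z * Real.sin θ - n * θ) θ]
    ring
  rw [h] at h2
  linarith

/-- Put `φ = nθ - z sin θ`, so `φ' > 0` and `φ'' = z sin θ ≥ 0` on `[0, π]`. Then `(1 - cos φ)/φ'`
has derivative `sin φ - (1 - cos φ) φ''/φ'^2 ≤ sin φ`. It is `0` at `θ = 0` and nonnegative at `π`,
so the integral of `sin φ` is nonnegative. -/
theorem schlafliSin_nonpos_of_lt {n : ℕ} {z : ℝ} (hz : 0 ≤ z) (hn : z < n) :
    schlafliSin n z ≤ 0 := by
  have hpos : ∀ θ : ℝ, 0 < n - z * Real.cos θ := fun θ => by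
    have := mul_le_mul_of_nonneg_left (Real.cos_le_one θ) hz
    linarith
  have hd : ∀ θ : ℝ, HasDerivAt
      (fun θ => (1 - Real.cos (n * θ - z * Real.sin θ)) / (n - z * Real.cos θ))
      ((Real.sin (n * θ - z * Real.sin θ) * (n - z * Real.cos θ) * (n - z * Real.cos θ)
        - (1 - Real.cos (n * θ - z * Real.sin θ)) * (z * Real.sin θ)) / (n - z * Real.cos θ) ^ 2)
      θ := fun θ => by
    have h1 := (((hasDerivAt_id θ).const_mul (n : ℝ)).sub
      ((Real.hasDerivAt_sin θ).const_mul z)).cos.const_sub 1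
    have h2 := ((Real.hasDerivAt_cos θ).const_mul z).const_sub (n : ℝ)
    have h3 := h1.div h2 (hpos θ).ne'
    simp only [id, mul_one] at h3
    refine h3.congr_deriv ?_
    simp
  have h := intervalIntegral.sub_le_integral_of_hasDeriv_right_of_le Real.pi_pos.le
    (fun θ _ => (hd θ).continuousAt.continuousWithinAt) (fun θ _ => (hd θ).hasDerivWithinAt)
    (φ := fun θ => Real.sin (n * θ - z * Real.sin θ))
    ((by fun_prop : Continuous _).continuousOn.integrableOn_compact isCompact_Icc)
    (fun θ hθ => by
      have hs := Real.sin_nonneg_of_nonneg_of_le_pi hθ.1.le hθ.2.le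
      have hc := Real.cos_le_one (n * θ - z * Real.sin θ)
      rw [div_le_iff₀ (pow_pos (hpos θ) 2)]
      have : 0 ≤ (1 - Real.cos (n * θ - z * Real.sin θ)) * (z * Real.sin θ) :=
        mul_nonneg (by linarith) (mul_nonneg hz hs)
      linarith)
  have e0 : (1 - Real.cos (n * 0 - z * Real.sin 0)) / (n - z * Real.cos 0) = 0 := by simp
  have e1 : 0 ≤ (1 - Real.cos (n * Real.pi - z * Real.sin Real.pi)) / (n - z * Real.cos Real.pi) :=
    div_nonneg (by linarith [Real.cos_le_one (n * Real.pi - z * Real.sin Real.pi)]) (hpos _).le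
  have e2 : schlafliSin n z = -∫ θ in (0 : ℝ)..Real.pi, Real.sin (n * θ - z * Real.sin θ) := by
    unfold schlafliSin
    rw [← intervalIntegral.integral_neg]
    refine intervalIntegral.integral_congr fun θ _ => ?_
    rw [← Real.sin_neg, neg_sub]
  rw [e2]
  linarith

/-- At `z = n` the denominator `φ'` of the strict case vanishes at `θ = 0`, so the endpoint is
reached by continuity from the left. -/
theorem schlafliSin_nonpos {n : ℕ} {z : ℝ} (hz : 0 < z) (hn : z ≤ n) : schlafliSin n z ≤ 0 := by
  have h : Tendsto (schlafliSin n) (𝓝[<] z) (𝓝 (schlafliSin n z)) :=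
    (hasDerivAt_schlafliSin n z).continuousAt.tendsto.mono_left nhdsWithin_le_nhds
  refine le_of_tendsto h ?_
  filter_upwards [Ioo_mem_nhdsLT hz] with y hy
  exact schlafliSin_nonpos_of_lt hy.1.le (hy.2.trans_le hn)

theorem sq_div_four_le_sinh {t : ℝ} (ht : 0 ≤ t) : t ^ 2 / 4 ≤ Real.sinh t := by
  rw [Real.sinh_eq]
  have h1 := Real.quadratic_le_exp_of_nonneg ht
  have h2 : Real.exp (-t) ≤ 1 := Real.exp_le_one_iff.2 (by linarith)
  linarith

theorem schlafli_exponent_le (ν : ℝ) {z : ℝ} (hz : 0 < z) :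
    ∀ᶠ t in atTop, ν * t - z * Real.sinh t ≤ -t := by
  -- Beyond this threshold `z t^2 / 4 ≥ (|ν| + 1) t`, and `sinh t ≥ t^2 / 4`.
  filter_upwards [eventually_ge_atTop (max 0 (4 * (|ν| + 1) / z))] with t ht
  have ht0 : 0 ≤ t := (le_max_left _ _).trans ht
  have ht1 : 4 * (|ν| + 1) / z ≤ t := (le_max_right _ _).trans ht
  rw [div_le_iff₀ hz] at ht1
  have h1 := mul_le_mul_of_nonneg_left (sq_div_four_le_sinh ht0) hz.le
  have h2 := mul_le_mul_of_nonneg_right (le_abs_self ν) ht0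
  have h3 := mul_le_mul_of_nonneg_right ht1 ht0
  nlinarith

theorem integrableOn_schlafliExp (ν : ℝ) {z : ℝ} (hz : 0 < z) :
    IntegrableOn (fun t => Real.exp (ν * t - z * Real.sinh t)) (Set.Ioi 0) := by
  refine integrable_of_isBigO_exp_neg one_pos (by fun_prop) ?_
  refine Asymptotics.IsBigO.of_bound 1 ?_
  filter_upwards [schlafli_exponent_le ν hz] with t ht
  rw [Real.norm_eq_abs, Real.norm_eq_abs, Real.abs_exp, Real.abs_exp, one_mul]
  exact Real.exp_le_exp.2 (by linarith)

theorem exp_mul_sinh (ν z t : ℝ) :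
    Real.sinh t * Real.exp (ν * t - z * Real.sinh t)
      = (Real.exp ((ν + 1) * t - z * Real.sinh t) - Real.exp ((ν - 1) * t - z * Real.sinh t)) / 2 := by
  rw [show (ν + 1) * t - z * Real.sinh t = t + (ν * t - z * Real.sinh t) by ring,
    show (ν - 1) * t - z * Real.sinh t = -t + (ν * t - z * Real.sinh t) by ring,
    Real.exp_add, Real.exp_add, Real.sinh_eq]
  ring

theorem exp_mul_cosh (ν z t : ℝ) :
    Real.cosh t * Real.exp (ν * t - z * Real.sinh t)
      = (Real.exp ((ν + 1) * t - z * Real.sinh t) + Real.exp ((ν - 1) * t - z * Real.sinh t)) / 2 := by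
  rw [show (ν + 1) * t - z * Real.sinh t = t + (ν * t - z * Real.sinh t) by ring,
    show (ν - 1) * t - z * Real.sinh t = -t + (ν * t - z * Real.sinh t) by ring,
    Real.exp_add, Real.exp_add, Real.cosh_eq]
  ring

theorem hasDerivAt_schlafliExp (ν : ℝ) {z : ℝ} (hz : 0 < z) :
    HasDerivAt (schlafliExp ν) ((schlafliExp (ν - 1) z - schlafliExp (ν + 1) z) / 2) z := by
  have h := hasDerivAt_integral_of_dominated_loc_of_deriv_le
    (μ := volume.restrict (Set.Ioi (0 : ℝ)))
    (F := fun z t => Real.exp (ν * t - z * Real.sinh t))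
    (F' := fun z t => -(Real.sinh t * Real.exp (ν * t - z * Real.sinh t))) (x₀ := z)
    -- Keeping the parameter above `z / 2` gives one integrable majorant for all nearby arguments.
    (bound := fun t => Real.sinh t * Real.exp (ν * t - z / 2 * Real.sinh t))
    (s := Set.Ioi (z / 2)) (Ioi_mem_nhds (by linarith))
    (Eventually.of_forall fun x => (by fun_prop : Continuous
      fun t => Real.exp (ν * t - x * Real.sinh t)).aestronglyMeasurable)
    (integrableOn_schlafliExp ν hz)
    (by fun_prop : Continuous
      fun t => -(Real.sinh t * Real.exp (ν * t - z * Real.sinh t))).aestronglyMeasurable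
    (by
      filter_upwards [ae_restrict_mem measurableSet_Ioi] with t ht x hx
      have hs : 0 ≤ Real.sinh t := Real.sinh_nonneg_iff.2 (Set.mem_Ioi.1 ht).le
      rw [norm_neg, Real.norm_eq_abs, abs_mul, Real.abs_exp, abs_of_nonneg hs]
      have := mul_le_mul_of_nonneg_right (Set.mem_Ioi.1 hx).le hs
      gcongr)
    (by
      simp_rw [exp_mul_sinh]
      exact ((integrableOn_schlafliExp _ (by linarith)).sub
        (integrableOn_schlafliExp _ (by linarith))).div_const 2)
    (Eventually.of_forall fun t x _ => by
      have := (((hasDerivAt_id x).mul_const (Real.sinh t)).const_sub (ν * t)).exp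
      refine this.congr_deriv ?_
      simp only [id]
      ring)
  refine h.2.congr_deriv ?_
  unfold schlafliExp
  rw [← integral_sub (integrableOn_schlafliExp _ hz) (integrableOn_schlafliExp _ hz),
    ← integral_div]
  refine integral_congr_ae (Eventually.of_forall fun t => ?_)
  simp only
  rw [exp_mul_sinh]
  ring

/-- Integrate the derivative of `exp(νt - z sinh t)`; the inhomogeneous `2` is twice its value at `t
= 0`. -/
theorem schlafliExp_recurrence (ν : ℝ) {z : ℝ} (hz : 0 < z) :
    z * (schlafliExp (ν - 1) z + schlafliExp (ν + 1) z) = 2 * ν * schlafliExp ν z + 2 := by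
  have e : ∀ t, Real.exp (ν * t - z * Real.sinh t) * (ν * 1 - z * Real.cosh t)
      = ν * Real.exp (ν * t - z * Real.sinh t)
        - z / 2 * (Real.exp ((ν + 1) * t - z * Real.sinh t)
          + Real.exp ((ν - 1) * t - z * Real.sinh t)) := fun t => by
    linear_combination -z * exp_mul_cosh ν z t
  have i1 := (integrableOn_schlafliExp ν hz).const_mul ν
  have i2 : IntegrableOn (fun t => z / 2 * (Real.exp ((ν + 1) * t - z * Real.sinh t)
      + Real.exp ((ν - 1) * t - z * Real.sinh t))) (Set.Ioi 0) :=
    ((integrableOn_schlafliExp (ν + 1) hz).add (integrableOn_schlafliExp (ν - 1) hz)).const_mul _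
  have ht : Tendsto (fun t => Real.exp (ν * t - z * Real.sinh t)) atTop (𝓝 0) := by
    refine Real.tendsto_exp_atBot.comp ?_
    exact tendsto_atBot_mono' _ (schlafli_exponent_le ν hz) tendsto_neg_atTop_atBot
  have h := integral_Ioi_of_hasDerivAt_of_tendsto (a := 0)
    (f := fun t => Real.exp (ν * t - z * Real.sinh t))
    (f' := fun t => Real.exp (ν * t - z * Real.sinh t) * (ν * 1 - z * Real.cosh t))
    (by fun_prop)
    (fun t _ => (((hasDerivAt_id t).const_mul ν).sub ((Real.hasDerivAt_sinh t).const_mul z)).exp)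
    (by simp_rw [e]; exact i1.sub i2) ht
  simp_rw [e] at h
  rw [integral_sub i1 i2, integral_const_mul, integral_const_mul,
    integral_add (integrableOn_schlafliExp _ hz) (integrableOn_schlafliExp _ hz)] at h
  simp only [mul_zero, Real.sinh_zero, sub_self, Real.exp_zero, zero_sub] at h
  unfold schlafliExp
  linarith

theorem schlafliExp_neg_lt {ν z : ℝ} (hν : 0 < ν) (hz : 0 < z) :
    schlafliExp (-ν) z < schlafliExp ν z := by
  rw [← sub_pos]
  unfold schlafliExp
  have i1 := integrableOn_schlafliExp ν hz
  have i2 := integrableOn_schlafliExp (-ν) hz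
  have hpos : ∀ t ∈ Set.Ioi (0 : ℝ),
      0 < Real.exp (ν * t - z * Real.sinh t) - Real.exp (-ν * t - z * Real.sinh t) := fun t ht => by
    have := mul_pos hν (Set.mem_Ioi.1 ht)
    exact sub_pos.2 (Real.exp_lt_exp.2 (by linarith))
  have i3 : IntegrableOn (fun t => Real.exp (ν * t - z * Real.sinh t)
      - Real.exp (-ν * t - z * Real.sinh t)) (Set.Ioi 0) := i1.sub i2
  rw [← integral_sub i1 i2, setIntegral_pos_iff_support_of_nonneg_ae _ i3]
  · have : Set.Ioi (0 : ℝ) ⊆ (Function.support fun t =>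
        Real.exp (ν * t - z * Real.sinh t) - Real.exp (-ν * t - z * Real.sinh t)) ∩ Set.Ioi 0 :=
      fun t ht => ⟨(hpos t ht).ne', ht⟩
    refine lt_of_lt_of_le ?_ (measure_mono this)
    simp
  · filter_upwards [ae_restrict_mem measurableSet_Ioi] with t ht
    exact (hpos t ht).le

theorem schlafliExp_nonneg (ν z : ℝ) : 0 ≤ schlafliExp ν z :=
  integral_nonneg fun _ => (Real.exp_pos _).le

/-- The Schläfli integral for the Neumann function of order `n`. -/
noncomputable def neumannIntegral (n : ℕ) (z : ℝ) : ℝ :=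
  (schlafliSin n z - schlafliExp n z - (-1) ^ n * schlafliExp (-n) z) / Real.pi

/-- The inhomogeneous terms cancel: with `m = n + 1` they are `2 - 2(-1)^m` from the sine part, `-2`
and `2(-1)^m` from the exponential ones. -/
theorem neumannIntegral_recurrence (n : ℕ) {z : ℝ} (hz : 0 < z) :
    z * (neumannIntegral n z + neumannIntegral (n + 2) z)
      = 2 * ((n : ℝ) + 1) * neumannIntegral (n + 1) z := by
  have h1 := schlafliSin_recurrence (n + 1) z
  have h2 := schlafliExp_recurrence ((n : ℝ) + 1) hz
  have h3 := schlafliExp_recurrence (-((n : ℝ) + 1)) hz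
  unfold neumannIntegral
  push_cast at h1 ⊢
  rw [show (n : ℝ) + 1 - 1 = n by ring, show (n : ℝ) + 1 + 1 = n + 2 by ring] at h1 h2
  rw [show -((n : ℝ) + 1) - 1 = -(n + 2) by ring, show -((n : ℝ) + 1) + 1 = -n by ring] at h3
  have := Real.pi_ne_zero
  field_simp
  rw [pow_succ] at h1
  rw [pow_succ, pow_succ]
  linear_combination h1 - h2 - (-1) ^ n * h3

theorem hasDerivAt_neumannIntegral_zero {z : ℝ} (hz : 0 < z) :
    HasDerivAt (neumannIntegral 0) (-neumannIntegral 1 z) z := by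
  have h1 := schlafliSin_recurrence 0 z
  have h := (((hasDerivAt_schlafliSin 0 z).sub (hasDerivAt_schlafliExp 0 hz)).sub
    (hasDerivAt_schlafliExp 0 hz)).div_const Real.pi
  have e : neumannIntegral 0
      = fun z => (schlafliSin 0 z - schlafliExp 0 z - schlafliExp 0 z) / Real.pi := by
    funext z
    simp [neumannIntegral]
  rw [e]
  refine h.congr_deriv ?_
  simp only [Nat.cast_zero, zero_sub, zero_add, pow_zero, sub_self, mul_zero, zero_mul,
    mul_eq_zero, hz.ne', false_or] at h1
  simp only [neumannIntegral, zero_sub, zero_add, Nat.cast_one]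
  linear_combination h1 / (2 * Real.pi)

theorem hasDerivAt_neumannIntegral_succ (n : ℕ) {z : ℝ} (hz : 0 < z) :
    HasDerivAt (neumannIntegral (n + 1))
      (neumannIntegral n z - ((n : ℝ) + 1) / z * neumannIntegral (n + 1) z) z := by
  have h := (((hasDerivAt_schlafliSin (n + 1 : ℕ) z).sub
    (hasDerivAt_schlafliExp (n + 1 : ℕ) hz)).sub
    ((hasDerivAt_schlafliExp (-(n + 1 : ℕ)) hz).const_mul ((-1) ^ (n + 1)))).div_const Real.pi
  refine h.congr_deriv ?_
  have hr := neumannIntegral_recurrence n hz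
  have e : ((n : ℝ) + 1) / z * neumannIntegral (n + 1) z
      = (neumannIntegral n z + neumannIntegral (n + 2) z) / 2 := by
    field_simp
    linarith
  rw [e]
  unfold neumannIntegral
  push_cast
  rw [show (n : ℝ) + 1 - 1 = n by ring, show (n : ℝ) + 1 + 1 = n + 2 by ring,
    show -((n : ℝ) + 1) - 1 = -(n + 2) by ring, show -((n : ℝ) + 1) + 1 = -n by ring,
    pow_succ, pow_succ]
  ring

/-- The comparison of the two exponential integrals decides odd `n`; even `n` also uses that the
smaller one is nonnegative. -/
theorem neumannIntegral_neg (n : ℕ) {z : ℝ} (hz : 0 < z) (hn : z ≤ n) :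
    neumannIntegral n z < 0 := by
  have hn0 : (0 : ℝ) < n := hz.trans_le hn
  have h1 := schlafliSin_nonpos hz hn
  have h2 := schlafliExp_neg_lt hn0 hz
  have h3 := schlafliExp_nonneg (-n) z
  refine div_neg_of_neg_of_pos ?_ Real.pi_pos
  rcases neg_one_pow_eq_or ℝ n with h | h <;> rw [h] <;> linarith

/-! ### Asymptotics of the Schläfli integrals at the origin. -/

theorem integral_log_mul_exp_neg :
    ∫ u in Set.Ioi (0 : ℝ), Real.log u * Real.exp (-u) = -Real.eulerMascheroniConstant := by
  have h1 := Complex.hasDerivAt_GammaIntegral (s := 1) (by simp)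
  have e : (∫ t in Set.Ioi (0 : ℝ), (t : ℂ) ^ ((1 : ℂ) - 1)
      * ((Real.log t : ℂ) * (Real.exp (-t) : ℂ)))
      = ((∫ u in Set.Ioi (0 : ℝ), Real.log u * Real.exp (-u) : ℝ) : ℂ) := by
    rw [← integral_complex_ofReal]
    refine integral_congr_ae (Eventually.of_forall fun t => ?_)
    simp
  rw [e] at h1
  have h2 : HasDerivAt Complex.Gamma
      ((∫ u in Set.Ioi (0 : ℝ), Real.log u * Real.exp (-u) : ℝ) : ℂ) ((1 : ℝ) : ℂ) := by
    rw [Complex.ofReal_one]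
    refine h1.congr_of_eventuallyEq ?_
    have : {s : ℂ | 0 < s.re} ∈ 𝓝 (1 : ℂ) :=
      (isOpen_lt continuous_const Complex.continuous_re).mem_nhds (by simp)
    filter_upwards [this] with s hs
    exact Complex.Gamma_eq_integral hs
  have h3 := h2.real_of_complex
  simp only [Complex.ofReal_re] at h3
  rw [Real.eulerMascheroniConstant_eq_neg_deriv, neg_neg]
  exact h3.deriv.symm

theorem integrableOn_log_mul_exp_neg :
    IntegrableOn (fun u => Real.log u * Real.exp (-u)) (Set.Ioi 0) := by
  -- A non-integrable function has Bochner integral `0` by convention, whereas this integral is `-γ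
  -- ≠ 0`.
  by_contra h
  have h1 := integral_undef h
  rw [integral_log_mul_exp_neg] at h1
  linarith [Real.one_half_lt_eulerMascheroniConstant]

theorem sinh_le_exp (t : ℝ) : Real.sinh t ≤ Real.exp t := by
  rw [Real.sinh_eq]
  linarith [Real.exp_pos t, Real.exp_pos (-t)]

theorem integrableOn_exp_exp (ν : ℝ) {x : ℝ} (hx : 0 < x) :
    IntegrableOn (fun t => Real.exp (ν * t - x * Real.exp t)) (Set.Ioi 0) := by
  refine (integrableOn_schlafliExp ν hx).mono' (by fun_prop : Continuous _).aestronglyMeasurable ?_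
  filter_upwards [ae_restrict_mem measurableSet_Ioi] with t ht
  rw [Real.norm_eq_abs, Real.abs_exp]
  have := mul_le_mul_of_nonneg_left (sinh_le_exp t) hx.le
  exact Real.exp_le_exp.2 (by linarith)

/-- Integrate by parts against `t`, then substitute `u = x e^t`, under which `t = log u - log x`. -/
theorem integral_exp_neg_mul_exp {x : ℝ} (hx : 0 < x) :
    ∫ t in Set.Ioi (0 : ℝ), Real.exp (-(x * Real.exp t))
      = (∫ u in Set.Ioi x, Real.log u * Real.exp (-u)) - Real.log x * Real.exp (-x) := by
  have i0 : IntegrableOn (fun t => Real.exp (-(x * Real.exp t))) (Set.Ioi 0) := by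
    simpa using integrableOn_exp_exp 0 hx
  have i1 : IntegrableOn (fun t => t * Real.exp (-(x * Real.exp t)) * (x * Real.exp t))
      (Set.Ioi 0) := by
    refine ((integrableOn_exp_exp 2 hx).const_mul x).mono'
      (by fun_prop : Continuous _).aestronglyMeasurable ?_
    filter_upwards [ae_restrict_mem measurableSet_Ioi] with t ht
    have ht0 : 0 < t := ht
    have h1 : t ≤ Real.exp t := by linarith [Real.add_one_le_exp t]
    rw [Real.norm_eq_abs, abs_of_nonneg (by positivity),
      show 2 * t - x * Real.exp t = t + (t + -(x * Real.exp t)) by ring, Real.exp_add, Real.exp_add]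
    calc _ ≤ Real.exp t * Real.exp (-(x * Real.exp t)) * (x * Real.exp t) := by gcongr
      _ = _ := by ring
  have hlim : Tendsto (fun t => t * Real.exp (-(x * Real.exp t))) atTop (𝓝 0) := by
    have h1 : Tendsto (fun t : ℝ => t ^ 1 * Real.exp (-t)) atTop (𝓝 0) :=
      Real.tendsto_pow_mul_exp_neg_atTop_nhds_zero 1
    refine squeeze_zero' ?_ ?_ h1
    · filter_upwards [eventually_ge_atTop 0] with t ht
      positivity
    · filter_upwards [eventually_ge_atTop 0, schlafli_exponent_le 0 hx] with t ht h2
      have := mul_le_mul_of_nonneg_left (sinh_le_exp t) hx.le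
      rw [pow_one]
      gcongr
      linarith
  have hparts := integral_Ioi_of_hasDerivAt_of_tendsto (a := 0)
    (f := fun t => t * Real.exp (-(x * Real.exp t)))
    (f' := fun t => Real.exp (-(x * Real.exp t))
      - t * Real.exp (-(x * Real.exp t)) * (x * Real.exp t))
    (by fun_prop)
    (fun t _ => by
      refine ((hasDerivAt_id t).mul ((Real.hasDerivAt_exp t).const_mul x).neg.exp).congr_deriv ?_
      simp only [id, Pi.neg_apply]
      ring)
    (i0.sub i1) hlim
  rw [integral_sub i0 i1] at hparts
  have himg : (fun t => x * Real.exp t) '' Set.Ici 0 ⊆ Set.Ici x := by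
    rintro _ ⟨t, ht, rfl⟩
    have := Real.one_le_exp (Set.mem_Ici.1 ht)
    exact Set.mem_Ici.2 (by nlinarith)
  have hi : ∀ s : Set ℝ, s ⊆ Set.Ioi 0 → IntegrableOn (fun u => Real.log u * Real.exp (-u)) s :=
    fun s hs => integrableOn_log_mul_exp_neg.mono_set hs
  have hx0 : Set.Ici x ⊆ Set.Ioi 0 := fun u hu => hx.trans_le hu
  have hexp : ∀ s : Set ℝ, s ⊆ Set.Ioi 0 → IntegrableOn (fun u => Real.exp (-u)) s :=
    fun s hs => (integrableOn_exp_neg_Ioi 0).mono_set hs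
  have hcov := integral_comp_mul_deriv_Ioi (a := 0) (f := fun t => x * Real.exp t)
    (f' := fun t => x * Real.exp t) (g := fun u => Real.log u * Real.exp (-u)
      - Real.log x * Real.exp (-u))
    (by fun_prop) (Real.tendsto_exp_atTop.const_mul_atTop hx)
    (fun t _ => ((Real.hasDerivAt_exp t).const_mul x).hasDerivWithinAt)
    (by
      have : ContinuousOn Real.log ((fun t => x * Real.exp t) '' Set.Ioi 0) :=
        Real.continuousOn_log.mono fun u hu => by
          have : u ∈ Set.Ioi (0 : ℝ) := hx0 (himg (Set.image_mono Set.Ioi_subset_Ici_self hu))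
          exact (Set.mem_Ioi.1 this).ne'
      fun_prop)
    ((hi _ (himg.trans hx0)).sub ((hexp _ (himg.trans hx0)).const_mul _))
    (by
      rw [integrableOn_Ici_iff_integrableOn_Ioi]
      refine i1.congr_fun (fun t _ => ?_) measurableSet_Ioi
      simp only [Function.comp]
      rw [Real.log_mul hx.ne' (Real.exp_pos t).ne', Real.log_exp]
      ring)
  have e1 : (∫ t in Set.Ioi (0 : ℝ), t * Real.exp (-(x * Real.exp t)) * (x * Real.exp t))
      = ∫ t in Set.Ioi (0 : ℝ), ((fun u => Real.log u * Real.exp (-u)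
      - Real.log x * Real.exp (-u)) ∘ fun t => x * Real.exp t) t * (x * Real.exp t) := by
    refine setIntegral_congr_fun measurableSet_Ioi fun t _ => ?_
    simp only [Function.comp]
    rw [Real.log_mul hx.ne' (Real.exp_pos t).ne', Real.log_exp]
    ring
  have hs : Set.Ioi x ⊆ Set.Ioi 0 := Set.Ioi_subset_Ici_self.trans hx0
  rw [Real.exp_zero, mul_one, integral_sub (hi _ hs) ((hexp _ hs).const_mul _),
    integral_const_mul, integral_exp_neg_Ioi] at hcov
  rw [e1, hcov] at hparts
  linarith

theorem tendsto_setIntegral_Ioi_nhdsGT_zero {f : ℝ → ℝ} (hf : IntegrableOn f (Set.Ioi 0)) :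
    Tendsto (fun x => ∫ u in Set.Ioi x, f u) (𝓝[>] 0) (𝓝 (∫ u in Set.Ioi 0, f u)) := by
  have h := (aecover_Ioi_of_Ioi (μ := volume) (A := (0 : ℝ)) (l := 𝓝[>] (0 : ℝ)) (a := id)
    (tendsto_id.mono_left nhdsWithin_le_nhds)).integral_tendsto_of_countably_generated hf
  refine h.congr' ?_
  filter_upwards [self_mem_nhdsWithin] with x hx
  rw [id, Measure.restrict_restrict measurableSet_Ioi,
    Set.inter_eq_left.2 (Set.Ioi_subset_Ioi (Set.mem_Ioi.1 hx).le)]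

theorem tendsto_integral_exp_neg_mul_exp_add_log :
    Tendsto (fun x => (∫ t in Set.Ioi (0 : ℝ), Real.exp (-(x * Real.exp t))) + Real.log x)
      (𝓝[>] 0) (𝓝 (-Real.eulerMascheroniConstant)) := by
  have h1 := tendsto_setIntegral_Ioi_nhdsGT_zero integrableOn_log_mul_exp_neg
  rw [integral_log_mul_exp_neg] at h1
  have h2 : Tendsto (fun x => (1 - Real.exp (-x)) * Real.log x) (𝓝[>] 0) (𝓝 0) := by
    have h3 : Tendsto (fun x => |x * Real.log x|) (𝓝[>] 0) (𝓝 0) := by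
      have := (Real.continuous_mul_log.abs.tendsto 0)
      simp only [zero_mul, abs_zero] at this
      exact this.mono_left nhdsWithin_le_nhds
    refine squeeze_zero_norm' ?_ h3
    filter_upwards [self_mem_nhdsWithin] with x hx
    have hx0 : 0 < x := hx
    rw [Real.norm_eq_abs, abs_mul, abs_mul]
    refine mul_le_mul_of_nonneg_right ?_ (abs_nonneg _)
    rw [abs_of_pos hx0, abs_of_nonneg]
    · linarith [Real.add_one_le_exp (-x)]
    · linarith [Real.exp_le_one_iff.2 (by linarith : -x ≤ 0)]
  have h4 := h1.add h2
  rw [add_zero] at h4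
  refine h4.congr' ?_
  filter_upwards [self_mem_nhdsWithin] with x hx
  rw [integral_exp_neg_mul_exp hx]
  ring

/-- Since `2 sinh t = e^t - e^{-t}`, the integrands differ by the factor `exp(-x e^{-t})`, within `x
e^{-t}` of `1`; this bound integrates to `x`. -/
theorem abs_schlafliExp_zero_sub_le {x : ℝ} (hx : 0 < x) :
    |schlafliExp 0 (2 * x) - ∫ t in Set.Ioi (0 : ℝ), Real.exp (-(x * Real.exp t))| ≤ x := by
  have i0 : IntegrableOn (fun t => Real.exp (-(x * Real.exp t))) (Set.Ioi 0) := by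
    simpa using integrableOn_exp_exp 0 hx
  have i1 := integrableOn_schlafliExp 0 (mul_pos two_pos hx)
  unfold schlafliExp
  rw [← integral_sub i1 i0]
  have h2 : ∫ t in Set.Ioi (0 : ℝ), x * Real.exp (-t) = x := by
    rw [integral_const_mul, integral_exp_neg_Ioi]; simp
  have h := norm_integral_le_of_norm_le ((integrableOn_exp_neg_Ioi 0).const_mul x)
    (f := fun t => Real.exp (0 * t - 2 * x * Real.sinh t) - Real.exp (-(x * Real.exp t)))
    (Eventually.filter_mono (ae_mono (le_refl _)) (by
      filter_upwards [ae_restrict_mem measurableSet_Ioi] with t ht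
      have ht0 : 0 < t := ht
      have e : -(x * Real.exp t)
          = (0 * t - 2 * x * Real.sinh t) + -(x * Real.exp (-t)) := by
        rw [Real.sinh_eq]; ring
      have hs : 0 < Real.sinh t := Real.sinh_pos_iff.2 ht0
      have h3 : Real.exp (0 * t - 2 * x * Real.sinh t) ≤ 1 :=
        Real.exp_le_one_iff.2 (by nlinarith [mul_pos hx hs])
      have h4 := Real.add_one_le_exp (-(x * Real.exp (-t)))
      have h5 : Real.exp (-(x * Real.exp (-t))) ≤ 1 :=
        Real.exp_le_one_iff.2 (by have := mul_pos hx (Real.exp_pos (-t)); linarith)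
      rw [e, Real.exp_add, ← mul_one_sub, Real.norm_eq_abs, abs_mul, Real.abs_exp,
        abs_of_nonneg (by linarith)]
      calc _ ≤ 1 * (x * Real.exp (-t)) := by gcongr; linarith
        _ = _ := one_mul _))
  rw [h2] at h
  exact h

theorem tendsto_schlafliExp_zero_add_log :
    Tendsto (fun x => schlafliExp 0 (2 * x) + Real.log x + Real.eulerMascheroniConstant)
      (𝓝[>] 0) (𝓝 0) := by
  have h1 : Tendsto (fun x => schlafliExp 0 (2 * x)
      - ∫ t in Set.Ioi (0 : ℝ), Real.exp (-(x * Real.exp t))) (𝓝[>] 0) (𝓝 0) := by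
    refine squeeze_zero_norm' ?_ (tendsto_id.mono_left nhdsWithin_le_nhds)
    filter_upwards [self_mem_nhdsWithin] with x hx
    exact abs_schlafliExp_zero_sub_le hx
  have h2 := (h1.add tendsto_integral_exp_neg_mul_exp_add_log).add_const
    Real.eulerMascheroniConstant
  rw [zero_add, neg_add_cancel] at h2
  refine h2.congr fun x => ?_
  ring

theorem tendsto_schlafliExp_neg_one :
    Tendsto (schlafliExp (-1)) (𝓝[>] 0) (𝓝 1) := by
  have h2 : ∫ t in Set.Ioi (0 : ℝ), Real.exp (-t) = 1 := by
    rw [integral_exp_neg_Ioi]; simp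
  suffices h : Tendsto (schlafliExp (-1)) (𝓝[>] 0) (𝓝 (∫ t in Set.Ioi (0 : ℝ), Real.exp (-t))) by
    rwa [h2] at h
  unfold schlafliExp
  refine tendsto_integral_filter_of_dominated_convergence (fun t => Real.exp (-t))
    (Eventually.of_forall fun x => (by fun_prop : Continuous _).aestronglyMeasurable) ?_
    (integrableOn_exp_neg_Ioi 0) (Eventually.of_forall fun t => ?_)
  · filter_upwards [self_mem_nhdsWithin] with x hx
    filter_upwards [ae_restrict_mem measurableSet_Ioi] with t ht
    have hx0 : 0 < x := hx
    rw [Real.norm_eq_abs, Real.abs_exp]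
    have := mul_pos hx0 (Real.sinh_pos_iff.2 (Set.mem_Ioi.1 ht))
    exact Real.exp_le_exp.2 (by linarith)
  · have : Continuous fun x => Real.exp (-1 * t - x * Real.sinh t) := by fun_prop
    have h := this.tendsto 0
    simp only [zero_mul, sub_zero, neg_one_mul] at h
    simpa using h.mono_left nhdsWithin_le_nhds

theorem tendsto_neumannIntegral_zero :
    Tendsto (fun x => Real.pi * neumannIntegral 0 (2 * x)
      - (2 * Real.log x + 2 * Real.eulerMascheroniConstant)) (𝓝[>] 0) (𝓝 0) := by
  have hc : Continuous (schlafliSin 0) :=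
    continuous_iff_continuousAt.2 fun z => (hasDerivAt_schlafliSin 0 z).continuousAt
  have h1 : Tendsto (fun x => schlafliSin 0 (2 * x)) (𝓝[>] 0) (𝓝 0) := by
    have h := (hc.comp (continuous_const_mul 2)).tendsto 0
    simp only [Function.comp, mul_zero] at h
    have e : schlafliSin 0 0 = 0 := by simp [schlafliSin]
    rw [e] at h
    exact h.mono_left nhdsWithin_le_nhds
  have h2 := h1.sub (tendsto_schlafliExp_zero_add_log.const_mul 2)
  rw [mul_zero, sub_zero] at h2
  refine h2.congr fun x => ?_
  simp only [neumannIntegral, Nat.cast_zero, neg_zero, pow_zero, one_mul]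
  field_simp [Real.pi_ne_zero]
  ring

/-- The recurrence at `ν = 0` isolates the pole: `E_1(2x) = 1/x - E_{-1}(2x)`, where `E_ν` is
`schlafliExp ν`. The two copies of `E_{-1} → 1` then cancel the sine part's limit `-2`. -/
theorem tendsto_neumannIntegral_one :
    Tendsto (fun x => Real.pi * neumannIntegral 1 (2 * x) + 1 / x) (𝓝[>] 0) (𝓝 0) := by
  have hc : Continuous (schlafliSin 1) :=
    continuous_iff_continuousAt.2 fun z => (hasDerivAt_schlafliSin 1 z).continuousAt
  have h1 : Tendsto (fun x => schlafliSin 1 (2 * x)) (𝓝[>] 0) (𝓝 (-2)) := by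
    have h := (hc.comp (continuous_const_mul 2)).tendsto 0
    simp only [Function.comp, mul_zero] at h
    have e : schlafliSin 1 0 = -2 := by
      simp [schlafliSin, Real.sin_neg]
      norm_num
    rw [e] at h
    exact h.mono_left nhdsWithin_le_nhds
  have h0 : Tendsto (fun x : ℝ => 2 * x) (𝓝[>] 0) (𝓝[>] 0) := by
    refine tendsto_nhdsWithin_iff.2 ⟨?_, ?_⟩
    · have := (continuous_const_mul (2 : ℝ)).tendsto 0
      rw [mul_zero] at this
      exact this.mono_left nhdsWithin_le_nhds
    · filter_upwards [self_mem_nhdsWithin] with x hx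
      exact mul_pos two_pos (Set.mem_Ioi.1 hx)
  have h2 := h1.add ((tendsto_schlafliExp_neg_one.comp h0).const_mul 2)
  norm_num at h2
  refine h2.congr' ?_
  filter_upwards [self_mem_nhdsWithin] with x hx
  have hx0 : 0 < x := hx
  have h3 := schlafliExp_recurrence 0 (mul_pos two_pos hx0)
  simp only [zero_sub, zero_add, mul_zero, zero_mul] at h3
  have h4 : schlafliExp 1 (2 * x) = 1 / x - schlafliExp (-1) (2 * x) := by
    field_simp
    linarith
  simp only [neumannIntegral, Nat.cast_one, pow_one, h4]
  field_simp [Real.pi_ne_zero]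
  ring

/-! ### Identification of the series with the integral. -/

/-- An energy argument: `D₀' = -2 D₁` and `D₁' = 2 D₀ - D₁/x`, so the cross terms in `(D₀² + D₁²)'`
cancel, leaving `-2 D₁²/x ≤ 0`. A nonnegative, nonincreasing function with limit `0` at `0+` is
zero. -/
theorem neumannW_zero_one_add_neumannIntegral {x : ℝ} (hx : 0 < x) :
    neumannW 0 (x ^ 2) + Real.pi * neumannIntegral 0 (2 * x) = 0
      ∧ neumannW 1 (x ^ 2) / x + Real.pi * neumannIntegral 1 (2 * x) = 0 := by
  set D₀ : ℝ → ℝ := fun x => neumannW 0 (x ^ 2) + Real.pi * neumannIntegral 0 (2 * x) with hD₀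
  set D₁ : ℝ → ℝ := fun x => neumannW 1 (x ^ 2) / x + Real.pi * neumannIntegral 1 (2 * x) with hD₁
  have hsq : ∀ x : ℝ, HasDerivAt (fun x : ℝ => x ^ 2) (2 * x) x := fun x => by
    simpa using hasDerivAt_pow 2 x
  have hdbl : ∀ x : ℝ, HasDerivAt (fun x : ℝ => 2 * x) 2 x := fun x => by
    simpa using (hasDerivAt_id x).const_mul 2
  have d₀ : ∀ x : ℝ, 0 < x → HasDerivAt D₀ (-2 * D₁ x) x := fun x hx => by
    have h1 := (hasDerivAt_neumannW_zero (q := x ^ 2) (by positivity)).comp x (hsq x)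
    have h2 := ((hasDerivAt_neumannIntegral_zero (z := 2 * x) (by positivity)).comp x
      (hdbl x)).const_mul Real.pi
    refine (h1.add h2).congr_deriv ?_
    simp only [hD₁]
    field_simp
    ring
  have d₁ : ∀ x : ℝ, 0 < x → HasDerivAt D₁ (2 * D₀ x - D₁ x / x) x := fun x hx => by
    have h1 := ((hasDerivAt_neumannW_one (q := x ^ 2) (by positivity)).comp x (hsq x)).div
      (hasDerivAt_id x) hx.ne'
    have h2 := ((hasDerivAt_neumannIntegral_succ 0 (z := 2 * x) (by positivity)).comp x
      (hdbl x)).const_mul Real.pi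
    refine (h1.add h2).congr_deriv ?_
    simp only [hD₁, hD₀, id, Function.comp, Nat.cast_zero, zero_add]
    field_simp
    ring
  have l₀ : Tendsto D₀ (𝓝[>] 0) (𝓝 0) := by
    have hs : Tendsto (fun x : ℝ => x ^ 2) (𝓝[>] 0) (𝓝 0) := by
      have := (continuous_pow (M := ℝ) 2).tendsto 0
      rw [zero_pow two_ne_zero] at this
      exact this.mono_left nhdsWithin_le_nhds
    have h := (tendsto_neumannW_zero_add_log.comp hs).add tendsto_neumannIntegral_zero
    rw [add_zero] at h
    refine h.congr fun x => ?_
    simp only [Function.comp, Real.log_pow, hD₀]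
    push_cast
    ring
  have l₁ : Tendsto D₁ (𝓝[>] 0) (𝓝 0) := by
    have h := tendsto_neumannW_one_sub_div.add tendsto_neumannIntegral_one
    rw [add_zero] at h
    refine h.congr fun x => ?_
    simp only [hD₁]
    ring
  have hE : ∀ x : ℝ, 0 < x →
      HasDerivAt (fun x => D₀ x ^ 2 + D₁ x ^ 2) (-2 * D₁ x ^ 2 / x) x := fun x hx => by
    refine (((d₀ x hx).pow 2).add ((d₁ x hx).pow 2)).congr_deriv ?_
    push_cast
    ring
  have hanti : AntitoneOn (fun x => D₀ x ^ 2 + D₁ x ^ 2) (Set.Ioi 0) := by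
    refine antitoneOn_of_deriv_nonpos (convex_Ioi 0)
      (fun x hx => (hE x hx).continuousAt.continuousWithinAt) ?_ ?_
    · rw [interior_Ioi]
      exact fun x hx => (hE x hx).differentiableAt.differentiableWithinAt
    · rw [interior_Ioi]
      intro x hx
      rw [(hE x hx).deriv]
      exact div_nonpos_of_nonpos_of_nonneg (by nlinarith [sq_nonneg (D₁ x)]) (Set.mem_Ioi.1 hx).le
  have hlim : Tendsto (fun x => D₀ x ^ 2 + D₁ x ^ 2) (𝓝[>] 0) (𝓝 0) := by
    simpa using (l₀.pow 2).add (l₁.pow 2)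
  have hle : D₀ x ^ 2 + D₁ x ^ 2 ≤ 0 := by
    refine ge_of_tendsto hlim ?_
    filter_upwards [Ioo_mem_nhdsGT hx] with y hy
    exact hanti (Set.mem_Ioi.2 hy.1) (Set.mem_Ioi.2 hx) hy.2.le
  exact ⟨pow_eq_zero_iff two_ne_zero |>.1 (by nlinarith [sq_nonneg (D₀ x), sq_nonneg (D₁ x)]),
    pow_eq_zero_iff two_ne_zero |>.1 (by nlinarith [sq_nonneg (D₀ x), sq_nonneg (D₁ x)])⟩

theorem neumannW_eq_neumannIntegral {x : ℝ} (hx : 0 < x) (n : ℕ) :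
    neumannW n (x ^ 2) = -(Real.pi * x ^ n * neumannIntegral n (2 * x)) := by
  obtain ⟨h0, h1⟩ := neumannW_zero_one_add_neumannIntegral hx
  induction n using Nat.twoStepInduction with
  | zero => rw [pow_zero]; linarith
  | one =>
    rw [div_add' _ _ _ hx.ne', div_eq_zero_iff, or_iff_left hx.ne'] at h1
    rw [pow_one]
    linarith
  | more n ih0 ih1 =>
    have h2 := neumannW_recurrence n (x ^ 2)
    have h3 := neumannIntegral_recurrence n (mul_pos two_pos hx)
    rw [ih0, ih1] at h2
    linear_combination h2 + Real.pi * x ^ (n + 1) / 2 * h3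

/-- Schläfli's integral for the Neumann function. -/
theorem besselY_eq_neumannIntegral (n : ℕ) {z : ℝ} (hz : 0 < z) :
    besselY n z = neumannIntegral n z := by
  rw [besselY_eq_neumannW n hz, neumannW_eq_neumannIntegral (half_pos hz),
    mul_div_cancel₀ z two_ne_zero]
  field_simp [Real.pi_ne_zero]

theorem besselY_neg {n : ℕ} {z : ℝ} (hz : 0 < z) (hn : z ≤ n) : besselY n z < 0 := by
  rw [besselY_eq_neumannIntegral n hz]
  exact neumannIntegral_neg n hz hn

/-! ### Monotonicity and bounds for `C_n`. -/

theorem neumannC_succ (n : ℕ) (z : ℝ) :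
    neumannC (n + 1) z = -besselY (n + 1) z * (z / 2) ^ (n + 1) * (Real.pi / (n.factorial : ℝ)) := by
  unfold neumannC
  push_cast
  rw [Real.Gamma_nat_eq_factorial]

theorem hasDerivAt_neumannC (n : ℕ) {z : ℝ} (hz : 0 < z) :
    HasDerivAt (neumannC (n + 1))
      (-besselY n z * (z / 2) ^ (n + 1) * (Real.pi / (n.factorial : ℝ))) z := by
  have e : neumannC (n + 1) =ᶠ[𝓝 z] fun z =>
      -neumannIntegral (n + 1) z * (z / 2) ^ (n + 1) * (Real.pi / (n.factorial : ℝ)) := by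
    filter_upwards [Ioi_mem_nhds hz] with y hy
    rw [neumannC_succ, besselY_eq_neumannIntegral _ hy]
  refine HasDerivAt.congr_of_eventuallyEq ?_ e
  have h := ((hasDerivAt_neumannIntegral_succ n hz).neg.mul
    (((hasDerivAt_id z).div_const 2).pow (n + 1))).mul_const (Real.pi / (n.factorial : ℝ))
  refine h.congr_deriv ?_
  rw [besselY_eq_neumannIntegral _ hz]
  simp
  field_simp
  ring

theorem neumannC_strictMonoOn (n : ℕ) :
    StrictMonoOn (neumannC n) {z : ℝ | 0 < z ∧ z + 1 ≤ (n : ℝ)} := by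
  rcases n with _ | n
  · rintro z ⟨hz, hn⟩
    simp only [Nat.cast_zero] at hn
    linarith
  have e : {z : ℝ | 0 < z ∧ z + 1 ≤ ((n + 1 : ℕ) : ℝ)} = Set.Ioc 0 (n : ℝ) := by
    ext z
    simp
  rw [e]
  refine strictMonoOn_of_deriv_pos (convex_Ioc 0 _)
    (fun z hz => (hasDerivAt_neumannC n hz.1).continuousAt.continuousWithinAt) fun z hz => ?_
  rw [interior_Ioc] at hz
  rw [(hasDerivAt_neumannC n hz.1).deriv]
  have := neg_pos.2 (besselY_neg hz.1 hz.2.le)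
  have := hz.1
  positivity

/-- The limit at `0+` yields only `1 ≤ C_n(z/2)`; strict growth from `z/2` to `z` makes the
inequality strict. -/
theorem one_lt_neumannC {n : ℕ} {z : ℝ} (hz : 0 < z) (hn : z + 1 ≤ n) : 1 < neumannC n z := by
  have hmono := neumannC_strictMonoOn n
  have h2 : 0 < z / 2 := half_pos hz
  have hm : z / 2 ∈ {z : ℝ | 0 < z ∧ z + 1 ≤ (n : ℝ)} := ⟨h2, by linarith⟩
  have hlt : neumannC n (z / 2) < neumannC n z := hmono hm ⟨hz, hn⟩ (half_lt_self hz)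
  refine lt_of_le_of_lt ?_ hlt
  obtain ⟨m, rfl⟩ : ∃ m, n = m + 1 := by
    refine Nat.exists_eq_succ_of_ne_zero ?_
    rintro rfl
    simp only [Nat.cast_zero] at hn
    linarith
  refine le_of_tendsto (tendsto_neumannC_nhdsGT_zero m) ?_
  filter_upwards [Ioo_mem_nhdsGT h2] with y hy
  exact (hmono ⟨hy.1, by linarith [hy.2]⟩ hm hy.2).le

theorem besselY_recurrence (n : ℕ) {z : ℝ} (hz : 0 < z) :
    z * (besselY n z + besselY (n + 2) z) = 2 * ((n : ℝ) + 1) * besselY (n + 1) z := by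
  simp only [besselY_eq_neumannIntegral _ hz]
  exact neumannIntegral_recurrence n hz

theorem neumannC_succ_lt {n : ℕ} {z : ℝ} (hz : 0 < z) (hn : z + 1 ≤ n) :
    neumannC (n + 1) z < neumannC n z := by
  obtain ⟨m, rfl⟩ : ∃ m, n = m + 1 := by
    refine Nat.exists_eq_succ_of_ne_zero ?_
    rintro rfl
    simp only [Nat.cast_zero] at hn
    linarith
  have hY : besselY m z < 0 := besselY_neg hz (by push_cast at hn; linarith)
  have hr := besselY_recurrence m hz
  -- Eliminating `Y_{m+1}` by the recurrence cancels `Y_{m+2}`, so only `Y_m` survives, and `z ≤ m`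
  -- fixes its sign.
  have key : neumannC (m + 1) z - neumannC (m + 2) z
      = -besselY m z * ((z / 2) ^ (m + 2) * (Real.pi / ((m + 1).factorial : ℝ))) := by
    have hm : besselY (m + 1) z = z / 2 * (besselY m z + besselY (m + 2) z) / ((m : ℝ) + 1) := by
      field_simp
      linarith
    rw [neumannC_succ, neumannC_succ (m + 1), hm, Nat.factorial_succ]
    push_cast
    field_simp
    ring
  rw [← sub_pos, key]
  have := neg_pos.2 hY
  positivity

theorem neumannC_strictAntiOn {z : ℝ} (hz : 0 < z) :
    StrictAntiOn (fun n : ℕ => neumannC n z) {n : ℕ | 1 ≤ n ∧ z + 1 ≤ (n : ℝ)} := by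
  rintro a ⟨_, ha⟩ b _ hab
  change neumannC b z < neumannC a z
  induction b, hab using Nat.le_induction with
  | base => exact neumannC_succ_lt hz ha
  | succ b hb ih =>
    have : (a : ℝ) ≤ b := by exact_mod_cast (Nat.lt_of_succ_le hb).le
    exact (neumannC_succ_lt hz (by linarith)).trans (ih ⟨by omega, by linarith⟩)

theorem lemma5 :
    (∀ n : ℕ, 1 ≤ n → ∀ z : ℝ, 0 < z → z + 1 ≤ (n : ℝ) → 1 < neumannC n z) ∧
    (∀ n : ℕ, 1 ≤ n →
      StrictMonoOn (fun z : ℝ => neumannC n z) {z : ℝ | 0 < z ∧ z + 1 ≤ (n : ℝ)} ∧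
      Tendsto (fun z : ℝ => neumannC n z) (𝓝[>] 0) (𝓝 1)) ∧
    (∀ z : ℝ, 0 < z →
      StrictAntiOn (fun n : ℕ => neumannC n z) {n : ℕ | 1 ≤ n ∧ z + 1 ≤ (n : ℝ)} ∧
      Tendsto (fun n : ℕ => neumannC n z) atTop (𝓝 1)) := by
  refine ⟨fun n _ z hz hn => one_lt_neumannC hz hn, fun n hn => ⟨neumannC_strictMonoOn n, ?_⟩,
    fun z hz => ⟨neumannC_strictAntiOn hz, tendsto_neumannC_atTop hz⟩⟩
  obtain ⟨m, rfl⟩ := Nat.exists_eq_succ_of_ne_zero (Nat.one_le_iff_ne_zero.1 hn)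
  exact tendsto_neumannC_nhdsGT_zero m
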